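/- Let $M$ be a matroid on a finite set $E$ and let $<$ be a linear order on $E$. For $S\subseteq E$ let $\operatorname{EA}(S)$ be the set of $e\in E\setminus S$ that are the maximum of some circuit of $M$ contained in $S\cup\{e\}$, and let $\operatorname{EP}(S)=(E\setminus S)\setminus \operatorname{EA}(S)$; let $\operatorname{IA}(S)$ be the set of $i\in S$ that are externally active for $E\setminus S$ in the dual matroid $M^\perp$, i.e. that are the maximum of some circuit of $M^\perp$ contained in $(E\setminus S)\cup\{i\}$. Every independent set $I$ of $M$ can be written uniquely as $I=B\setminus Y_I$ with $B$ a basis and $Y_I\subseteq\operatorname{IA}(B)$; independent sets $I,J$ are called internally related if they have the same $B$. The external/internal order on the set $\mathcal I(M)$ of independent sets is defined by: $I\le_{ext/int}J$ if and only if either $I,J$ are internally related and $I\subseteq J$, or they are not internally related and $(I\setminus\operatorname{IA}(I))\cup\operatorname{EA}(I)\subseteq (J\setminus\operatorname{IA}(J))\cup\operatorname{EA}(J)$. The augmented external activity complex $\Delta_M$ is the simplicial complex on $\{x_e,y_e,z_e : e\in E\}$ generated by the sets \[F(I)=\{x_e: e\in I\cup\operatorname{EP}(I)\}\cup\{y_e: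 e\in Y_I\}\cup\{z_e: e\in I\cup\operatorname{EA}(I)\},\qquad I\in\mathcal I(M).\] An ordering $F_1,\dots,F_s$ (without repetition) of the facets of a pure simplicial complex $\Delta$ is a shelling if for all $i<k$ there are $j<k$ and $e\in F_k$ with $F_i\cap F_k\subseteq F_j\cap F_k=F_k\setminus\{e\}$. The restriction set $R_j$ of $F_j$ is then the subset of $F_j$ such that, for all $A\subseteq F_j$, one has $R_j\subseteq A$ if and only if $A\not\subseteq F_i$ for every $i<j$. Each face $G$ of $\Delta$ lies in exactly one interval $[R_i,F_i]$, and one puts $R(G)=R_i$. The shelling has property (H), and is called an $H$-shelling, if for every face $G$, every facet $F\supseteq G$ and every $e\in G$ with $e\in R(F)$ one has $e\in R(G)$. It is an $h$-shelling if $\Gamma=\{R_1,\dots,R_s\}$ is a simplicial complex, which is then called its $h$-complex. Statement: for every linear extension $\prec$ of $\le_{ext/int}$ on $\mathcal I(M)$, the sets $F(I)$, $I\in\mathcal I(M)$, listed in the order $\prec$, are the facets of $\Delta_M$ without repetition and form a shelling of $\Delta_M$ that has property (H), i.e. an $H$-shelling. Moreover this shelling is an $h$-shelling, and its $h$-complex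 is isomorphic, as a simplicial complex, to the independence complex $\mathcal I(M)$ of $M$. -/

import Mathlib

open Set

/-! ### Simplicial complexes (the empty set is a face), shellings, restriction sets -/

/-- A simplicial complex with vertices among the elements of `V`: a family of finite sets that is
closed under taking subsets and contains the empty face. Not every element of `V` has to be a
vertex. (Mathlib's `PreAbstractSimplicialComplex` leaves the empty face out; here it is needed, as
the restriction set of the first facet is empty and the empty set is independent.) -/
@[ext]
structure SetComplex (V : Type*) where
  faces : Set (Set V)
  finite_of_mem : ∀ s ∈ faces, s.Finite
  empty_mem : ∅ ∈ faces
  down_closed : ∀ s ∈ faces, ∀ t ⊆ s, t ∈ faces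

namespace SetComplex

variable {V W : Type*}

/-- The vertices of the complex. -/
def vertices (K : SetComplex V) : Set V := {v | {v} ∈ K.faces}

/-- A facet is an inclusion-maximal face. -/
def IsFacet (K : SetComplex V) (s : Set V) : Prop := Maximal (· ∈ K.faces) s

/-- All facets have the same cardinality. -/
def Pure (K : SetComplex V) : Prop :=
  ∀ s t, K.IsFacet s → K.IsFacet t → s.ncard = t.ncard

/-- Isomorphism of simplicial complexes: a bijection between the vertices under which a set of
vertices is a face on one side if and only if its image is a face on the other side. -/
def Isomorphic (K : SetComplex V) (L : SetComplex W) : Prop :=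
  ∃ f : K.vertices ≃ L.vertices, ∀ s : Set K.vertices,
    (Subtype.val '' s ∈ K.faces ↔ Subtype.val '' (f '' s) ∈ L.faces)

end SetComplex

section Shelling

variable {V ι : Type*}

/-- The facets of `K`, listed without repetition as `F i` along the finite index set `ι` with
strict total order `lt`, form a shelling order of the pure complex `K`. -/
structure IsShellingOrder (K : SetComplex V) (lt : ι → ι → Prop) (F : ι → Set V) : Prop where
  finite : Finite ι
  total : IsStrictTotalOrder ι lt
  pure : K.Pure
  injective : Function.Injective F
  range_eq : Set.range F = {s | K.IsFacet s}
  shelling : ∀ i k, lt i k → ∃ j, lt j k ∧ ∃ e ∈ F k,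
    F i ∩ F k ⊆ F j ∩ F k ∧ F j ∩ F k = F k \ {e}

/-- `R` is the restriction set of the facet `F j`: among the subsets `A` of `F j`, those that lie
in no earlier facet are exactly those that contain `R`. -/
def IsRestrictionSet (lt : ι → ι → Prop) (F : ι → Set V) (j : ι) (R : Set V) : Prop :=
  R ⊆ F j ∧ ∀ A ⊆ F j, (R ⊆ A ↔ ∀ i, lt i j → ¬ A ⊆ F i)

theorem IsRestrictionSet.unique {lt : ι → ι → Prop} {F : ι → Set V} {j : ι} {R R' : Set V}
    (h : IsRestrictionSet lt F j R) (h' : IsRestrictionSet lt F j R') : R = R' :=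
  Subset.antisymm ((h.2 R' h'.1).2 ((h'.2 R' h'.1).1 Subset.rfl))
    ((h'.2 R h.1).2 ((h.2 R h.1).1 Subset.rfl))

/-- `R j` is the restriction set of `F j`, for every `j`. -/
def IsRestrictionMap (lt : ι → ι → Prop) (F R : ι → Set V) : Prop :=
  ∀ j, IsRestrictionSet lt F j (R j)

/-- Property (H) for the facets `F` of `K` with restriction sets `R`: if a face `G` is contained in
a facet `F j`, and `e ∈ G` lies in `R (F j) = R j`, then `e ∈ R (G)`, where `R (G) = R i` for the
index `i` with `R i ⊆ G ⊆ F i`. -/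
def PropertyH (K : SetComplex V) (F R : ι → Set V) : Prop :=
  ∀ G ∈ K.faces, ∀ j, G ⊆ F j → ∀ e ∈ G, e ∈ R j →
    ∃ i, R i ⊆ G ∧ G ⊆ F i ∧ e ∈ R i

/-- An H-shelling: a shelling with property (H). -/
def IsCapitalHShelling (K : SetComplex V) (lt : ι → ι → Prop) (F : ι → Set V) : Prop :=
  IsShellingOrder K lt F ∧ ∃ R, IsRestrictionMap lt F R ∧ PropertyH K F R

/-- An h-shelling with h-complex `Γ`: a shelling whose restriction sets are exactly the faces of
the simplicial complex `Γ`. -/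
def IsSmallHShelling (K : SetComplex V) (lt : ι → ι → Prop) (F : ι → Set V)
    (Γ : SetComplex V) : Prop :=
  IsShellingOrder K lt F ∧ ∃ R, IsRestrictionMap lt F R ∧ Γ.faces = Set.range R

end Shelling

/-! ### Matroid activities and the external/internal order -/

namespace Matroid

variable {α : Type*}

/-- The independence complex. -/
def indepComplex (M : Matroid α) [M.Finite] : SetComplex α where
  faces := {I | M.Indep I}
  finite_of_mem I hI := M.set_finite I hI.subset_ground
  empty_mem := M.empty_indep
  down_closed _ hs _ ht := Indep.subset hs ht

/-- The type of independent sets. It is not reducible, so that it does not inherit the inclusion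
order. -/
def IndepSets (M : Matroid α) : Type _ := {I : Set α // M.Indep I}

variable [LinearOrder α]

/-- Externally active elements: `e ∈ E \ S` is the maximum of a circuit contained in `S ∪ e`. -/
def extActive (M : Matroid α) (S : Set α) : Set α :=
  {e | e ∈ M.E \ S ∧ ∃ C, M.IsCircuit C ∧ C ⊆ insert e S ∧ IsGreatest C e}

/-- Externally passive elements. -/
def extPassive (M : Matroid α) (S : Set α) : Set α := (M.E \ S) \ M.extActive S

/-- Internally active elements: `i ∈ S` is externally active for `E \ S` in the dual matroid. -/
def intActive (M : Matroid α) (S : Set α) : Set α :=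
  {i | i ∈ S ∧ i ∈ M✶.extActive (M.E \ S)}

/-- `I` is obtained from the basis `B` by deleting internally active elements of `B`, namely
the elements of `B \ I`. -/
def RelatedBasis (M : Matroid α) (I B : Set α) : Prop :=
  M.IsBase B ∧ I ⊆ B ∧ B \ I ⊆ M.intActive B

/-- `I` and `J` are internally related. -/
def InternallyRelated (M : Matroid α) (I J : Set α) : Prop :=
  ∃ B, M.RelatedBasis I B ∧ M.RelatedBasis J B

/-- The external/internal order on independent sets. -/
def ExtIntLE (M : Matroid α) (I J : M.IndepSets) : Prop :=
  (¬ M.InternallyRelated I.1 J.1 ∧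
    (I.1 \ M.intActive I.1) ∪ M.extActive I.1 ⊆ (J.1 \ M.intActive J.1) ∪ M.extActive J.1) ∨
  (M.InternallyRelated I.1 J.1 ∧ I.1 ⊆ J.1)

/-- `lt` is the strict order of a linear extension of the external/internal order. -/
def IsExtIntLinearExtension (M : Matroid α) (lt : M.IndepSets → M.IndepSets → Prop) : Prop :=
  IsStrictTotalOrder M.IndepSets lt ∧ ∀ I J, M.ExtIntLE I J → I ≠ J → lt I J

/-- The set `Y` in the decomposition `I = B \ Y` of an independent set with `B` a basis and
`Y ⊆ IA(B)`. (The basis `B` is unique, so the union over all such `B` that is written here has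
only one term.) -/
def deleted (M : Matroid α) (I : Set α) : Set α := {e | ∃ B, M.RelatedBasis I B ∧ e ∈ B \ I}

end Matroid

/-! ### The augmented external activity complex -/

/-- The ground set `E(x,y,z)`. -/
inductive XYZ (α : Type*) where
  | x : α → XYZ α
  | y : α → XYZ α
  | z : α → XYZ α

namespace Matroid

variable {α : Type*} [LinearOrder α]

/-- `F(I) = x_{I ∪ EP(I)} y_Y z_{I ∪ EA(I)}`, where `I = B \ Y`. -/
def augFacet (M : Matroid α) (I : M.IndepSets) : Set (XYZ α) :=
  XYZ.x '' (I.1 ∪ M.extPassive I.1) ∪ XYZ.y '' M.deleted I.1 ∪ XYZ.z '' (I.1 ∪ M.extActive I.1)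

theorem augFacet_finite (M : Matroid α) [M.Finite] (I : M.IndepSets) : (M.augFacet I).Finite := by
  have hI : I.1 ⊆ M.E := I.2.subset_ground
  refine ((Set.Finite.image _ ?_).union (Set.Finite.image _ ?_)).union (Set.Finite.image _ ?_)
  · exact M.set_finite _ (union_subset hI fun e he => he.1.1)
  · refine M.set_finite _ ?_
    rintro e ⟨B, hB, he⟩
    exact hB.1.subset_ground he.1
  · exact M.set_finite _ (union_subset hI fun e he => he.1.1)

/-- The augmented external activity complex: the complex generated by the sets `F(I)`. -/
def augComplex (M : Matroid α) [M.Finite] : SetComplex (XYZ α) where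
  faces := {G | ∃ I, G ⊆ M.augFacet I}
  finite_of_mem := fun _ ⟨I, h⟩ => (M.augFacet_finite I).subset h
  empty_mem := ⟨⟨∅, M.empty_indep⟩, empty_subset _⟩
  down_closed := fun _ ⟨I, h⟩ _ ht => ⟨I, ht.trans h⟩

end Matroid

namespace Matroid

variable {α : Type*} {M : Matroid α} {S X I J B C : Set α} {e : α}

/-! ### Closure in the dual matroid -/

section Dual

/-! The restriction set of `F(I)` is the copy `z_I` of `I`. Given a face `G ⊆ F(J)`, let `C` be its
z-part and `I` the basis of `C` built greedily from the smallest element up. Then `z_I ⊆ G ⊆ F(I)`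
and `C ∩ J ⊆ I` (`exists_z_image_subset_subset_augFacet`); the last inclusion is property (H).
Conversely, `z_I ⊆ F(J)` means `I ⊆ J ∪ EA(J)`, which forces `I ≤ J` in the external/internal order
(`extIntLE_of_subset`). So in any linear extension the subsets of `F(J)` lying in no earlier facet
are exactly those containing `z_J`. The shelling follows, and the restriction sets form a copy of
the independence complex. All activities are rewritten as closure conditions, and `Y_I` as a greedy
completion from the largest element down. -/

theorem mem_dual_closure_iff (heE : e ∈ M.E) (heX : e ∉ X) :
    e ∈ M✶.closure X ↔ e ∉ M.closure ((M.E \ X) \ {e}) := by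
  constructor
  · intro he hcl
    obtain ⟨K, hKX, hK, heK⟩ := exists_isCircuit_of_mem_closure he heX
    obtain ⟨D, hDX, hD, heD⟩ := exists_isCircuit_of_mem_closure hcl (by simp)
    refine hD.inter_isCocircuit_ne_singleton (e := e) (K := K) hK ?_
    refine Subset.antisymm ?_ (by simp [heD, heK])
    rintro f ⟨hfD, hfK⟩
    by_contra hfe
    exact (((hDX hfD).resolve_left hfe).1.2) ((hKX hfK).resolve_left hfe)
  · intro hcl
    obtain ⟨I, hI⟩ := M.exists_isBasis ((M.E \ X) \ {e}) (sdiff_subset.trans sdiff_subset)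
    have hins : M.Indep (insert e I) := by
      rw [hI.indep.insert_indep_iff]
      exact Or.inl ⟨heE, by rwa [hI.closure_eq_closure]⟩
    -- If `K` had an element `f` outside `X ∪ {e}`, a circuit in `I ∪ {f}` through `f` would meet
    -- the cocircuit `K` in `f` alone.
    obtain ⟨K, hK, hKI⟩ := hins.exists_isCocircuit_inter_eq_mem (mem_insert e I)
    have heK : e ∈ K := (hKI.symm.subset (mem_singleton e)).1
    rw [mem_closure_iff_exists_isCircuit heX]
    refine ⟨K, fun f hfK => ?_, hK, heK⟩
    by_contra hf
    rw [mem_insert_iff, not_or] at hf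
    have hfI : f ∉ I := fun h => hf.1 (hKI.subset ⟨hfK, mem_insert_of_mem e h⟩)
    have hfcl : f ∈ M.closure I := hI.subset_closure ⟨⟨hK.subset_ground hfK, hf.2⟩, hf.1⟩
    obtain ⟨D, hDI, hD, hfD⟩ := exists_isCircuit_of_mem_closure hfcl hfI
    refine hD.inter_isCocircuit_ne_singleton (e := f) hK ?_
    refine Subset.antisymm ?_ (by simp [hfD, hfK])
    rintro g ⟨hgD, hgK⟩
    refine (hDI hgD).resolve_right fun hgI => ?_
    obtain rfl : g = e := hKI.subset ⟨hgK, mem_insert_of_mem e hgI⟩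
    exact (hI.subset hgI).2 rfl

end Dual

/-! ### The candidate h-complex -/

section ZIndepComplex

/-- The independence complex with the vertex `e` renamed to `z e`. -/
def zIndepComplex (M : Matroid α) [M.Finite] : SetComplex (XYZ α) where
  faces := range fun I : M.IndepSets => XYZ.z '' I.1
  finite_of_mem := by
    rintro _ ⟨I, rfl⟩
    exact (M.set_finite _ (Indep.subset_ground I.2)).image _
  empty_mem := ⟨⟨∅, M.empty_indep⟩, image_empty _⟩
  down_closed := by
    rintro _ ⟨I, rfl⟩ t ht
    obtain ⟨J, hJI, rfl⟩ := subset_image_iff.1 ht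
    exact ⟨⟨J, Indep.subset I.2 hJI⟩, rfl⟩

theorem z_image_mem_zIndepComplex [M.Finite] :
    XYZ.z '' S ∈ M.zIndepComplex.faces ↔ S ∈ M.indepComplex.faces := by
  have hinj : Function.Injective (XYZ.z (α := α)) := fun _ _ h => XYZ.z.inj h
  constructor
  · rintro ⟨I, hI⟩
    exact hinj.image_injective hI ▸ I.2
  · exact fun h => ⟨⟨S, h⟩, rfl⟩

theorem zIndepComplex_isomorphic [M.Finite] : M.zIndepComplex.Isomorphic M.indepComplex := by
  have hinj : Function.Injective (XYZ.z (α := α)) := fun _ _ h => XYZ.z.inj h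
  have hmem : ∀ e, XYZ.z e ∈ M.zIndepComplex.vertices ↔ e ∈ M.indepComplex.vertices := fun e => by
    have := z_image_mem_zIndepComplex (M := M) (S := {e})
    rwa [image_singleton] at this
  let g : M.indepComplex.vertices → M.zIndepComplex.vertices :=
    fun e => ⟨XYZ.z e.1, (hmem e).2 e.2⟩
  have hg : Function.Bijective g := by
    refine ⟨fun a b h => Subtype.ext (hinj (congrArg Subtype.val h)), ?_⟩
    rintro ⟨v, hv⟩
    obtain ⟨I, hI⟩ := id hv
    obtain ⟨e, -, rfl⟩ : v ∈ XYZ.z '' I.1 := hI.symm.subset (mem_singleton v)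
    exact ⟨⟨e, (hmem e).1 hv⟩, rfl⟩
  let f := Equiv.ofBijective g hg
  refine ⟨f.symm, fun s => ?_⟩
  have hs : Subtype.val '' s = XYZ.z '' (Subtype.val '' (f.symm '' s)) := by
    conv_lhs => rw [← f.image_symm_image s]
    simp only [image_image]
    rfl
  rw [hs, z_image_mem_zIndepComplex]

end ZIndepComplex

variable [LinearOrder α]

/-! ### Activities as closure conditions -/

theorem mem_extActive_iff :
    e ∈ M.extActive S ↔ e ∈ M.E ∧ e ∉ S ∧ e ∈ M.closure (S ∩ Iio e) := by
  constructor
  · rintro ⟨⟨heE, heS⟩, D, hD, hDS, heD, hmax⟩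
    refine ⟨heE, heS, M.closure_subset_closure ?_ (hD.mem_closure_sdiff_singleton_of_mem heD)⟩
    rintro f ⟨hfD, hfe⟩
    exact ⟨(hDS hfD).resolve_left hfe, lt_of_le_of_ne (hmax hfD) hfe⟩
  · rintro ⟨heE, heS, hcl⟩
    obtain ⟨D, hDS, hD, heD⟩ := exists_isCircuit_of_mem_closure hcl (by simp)
    refine ⟨⟨heE, heS⟩, D, hD, hDS.trans (insert_subset_insert inter_subset_left), heD, ?_⟩
    intro f hfD
    rcases hDS hfD with rfl | hf
    · exact le_rfl
    · exact hf.2.le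

theorem mem_intActive_iff (hS : S ⊆ M.E) :
    e ∈ M.intActive S ↔ e ∈ S ∧ e ∉ M.closure ((S \ {e}) ∪ Ioi e) := by
  refine and_congr_right fun heS => ?_
  rw [mem_extActive_iff, mem_dual_closure_iff (hS heS) (by simp)]
  have hset : (M.E \ ((M.E \ S) ∩ Iio e)) \ {e} = ((S \ {e}) ∪ Ioi e) ∩ M.E := by
    ext f
    have := @hS f
    have h3 : f < e ∨ f = e ∨ e < f := lt_trichotomy f e
    have h4 : e < f → f ≠ e ∧ ¬ f < e := fun h => ⟨h.ne', h.le.not_gt⟩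
    simp only [mem_sdiff, mem_inter_iff, mem_Iio, mem_singleton_iff, mem_union, mem_Ioi]
    tauto
  rw [hset, closure_inter_ground]
  simp [heS, hS heS]

theorem extActive_subset_closure : M.extActive S ⊆ M.closure S := fun _ he =>
  M.closure_subset_closure inter_subset_left (mem_extActive_iff.1 he).2.2

theorem Indep.notMem_closure_inter_Iio (hJ : M.Indep J) (he : e ∈ J) :
    e ∉ M.closure (J ∩ Iio e) := fun h =>
  hJ.notMem_closure_sdiff_of_mem he (M.closure_subset_closure
    (show J ∩ Iio e ⊆ J \ {e} from fun _ hf => ⟨hf.1, ne_of_lt hf.2⟩) h)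

/-- An element of `EA(J)` below `e` is spanned by still smaller elements of `J`. -/
theorem closure_inter_Iio_subset (hIJ : I ⊆ J ∪ M.extActive J) (hJ : J ⊆ M.E) (e : α) :
    M.closure (I ∩ Iio e) ⊆ M.closure (J ∩ Iio e) := by
  refine closure_subset_closure_of_subset_closure ?_
  rintro f ⟨hfI, hfe⟩
  rcases hIJ hfI with hf | hf
  · exact M.subset_closure (J ∩ Iio e) (inter_subset_left.trans hJ) ⟨hf, hfe⟩
  · exact M.closure_subset_closure
      (inter_subset_inter_right _ (Iio_subset_Iio (le_of_lt hfe))) (mem_extActive_iff.1 hf).2.2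

theorem Indep.extActive_subset_extActive (hJ : M.Indep J) (hIJ : I ⊆ J ∪ M.extActive J) :
    M.extActive I ⊆ M.extActive J := by
  intro e he
  rw [mem_extActive_iff] at he ⊢
  have h := closure_inter_Iio_subset hIJ hJ.subset_ground e he.2.2
  exact ⟨he.1, fun heJ => hJ.notMem_closure_inter_Iio heJ h, h⟩

/-! ### Greedy completion and the related basis -/

/-- The elements that a greedy algorithm, running through the ground set from the largest element
down, adds to `I` in order to complete it to a basis. -/
def greedyCompletion (M : Matroid α) (I : Set α) : Set α :=
  {e | e ∈ M.E ∧ e ∉ M.closure (I ∪ Ioi e)}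

theorem disjoint_greedyCompletion (hI : I ⊆ M.E) : Disjoint I (M.greedyCompletion I) := by
  rw [Set.disjoint_left]
  intro e heI he
  refine he.2 ?_
  rw [← closure_inter_ground]
  exact M.subset_closure _ inter_subset_right ⟨Or.inl heI, hI heI⟩

theorem greedyCompletion_anti (h : I ⊆ M.closure J) :
    M.greedyCompletion J ⊆ M.greedyCompletion I := by
  rintro e ⟨heE, he⟩
  refine ⟨heE, fun h' => he ?_⟩
  rw [← closure_union_closure_left_eq]
  exact M.closure_subset_closure (union_subset_union_left _ h) h'

/-- The least element of `C \ I` is spanned by the rest of `C`, which lies in `I` or above it. -/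
theorem IsCircuit.exists_notMem_greedyCompletion [M.Finite] (hC : M.IsCircuit C)
    (hCI : ¬ C ⊆ I) : ∃ f ∈ C \ I, f ∉ M.greedyCompletion I ∧ ∀ g ∈ C \ I, f ≤ g := by
  have hfin : (C \ I).Finite := (M.set_finite C hC.subset_ground).subset sdiff_subset
  obtain ⟨f, hf, hmin⟩ := exists_min_image (C \ I) id hfin (sdiff_nonempty.2 hCI)
  refine ⟨f, hf, fun h => h.2 ?_, hmin⟩
  refine M.closure_subset_closure ?_ (hC.mem_closure_sdiff_singleton_of_mem hf.1)
  rintro g ⟨hgC, hgf⟩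
  by_cases hgI : g ∈ I
  · exact Or.inl hgI
  · exact Or.inr (lt_of_le_of_ne (hmin g ⟨hgC, hgI⟩) (Ne.symm hgf))

theorem Indep.union_greedyCompletion_indep [M.Finite] (hI : M.Indep I) :
    M.Indep (I ∪ M.greedyCompletion I) := by
  rw [indep_iff_forall_subset_not_isCircuit
    (union_subset hI.subset_ground fun e he => he.1)]
  intro C hCsub hC
  obtain ⟨f, hf, hfY, -⟩ := hC.exists_notMem_greedyCompletion
    (fun h => hC.not_indep (hI.subset h))
  exact hfY ((hCsub hf.1).resolve_left hf.2)

theorem Indep.union_greedyCompletion_isBase [M.Finite] (hI : M.Indep I) :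
    M.IsBase (I ∪ M.greedyCompletion I) := by
  have hind := hI.union_greedyCompletion_indep
  rw [isBase_iff_indep_closure_eq]
  refine ⟨hind, Subset.antisymm (M.closure_subset_ground _) ?_⟩
  by_contra hne
  -- For the largest unspanned `e`, everything above `e` is spanned, so rejecting `e` would put it
  -- in the span.
  obtain ⟨e, ⟨heE, he⟩, hmax⟩ := exists_max_image (M.E \ M.closure (I ∪ M.greedyCompletion I)) id
    ((M.ground_finite).subset sdiff_subset) (sdiff_nonempty.2 hne)
  have heY : e ∉ M.greedyCompletion I := fun h =>
    he (M.subset_closure _ hind.subset_ground (Or.inr h))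
  have hcl : e ∈ M.closure ((I ∪ Ioi e) ∩ M.E) := by
    rw [closure_inter_ground]
    by_contra h
    exact heY ⟨heE, h⟩
  refine he (closure_subset_closure_of_subset_closure ?_ hcl)
  rintro f ⟨hf | hf, hfE⟩
  · exact M.subset_closure _ hind.subset_ground (Or.inl hf)
  · by_contra hfcl
    exact (hmax f ⟨hfE, hfcl⟩).not_gt hf

theorem Indep.relatedBasis_union_greedyCompletion [M.Finite] (hI : M.Indep I) :
    M.RelatedBasis I (I ∪ M.greedyCompletion I) := by
  have hB := hI.union_greedyCompletion_isBase
  refine ⟨hB, subset_union_left, ?_⟩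
  rintro e ⟨heB, heI⟩
  have heY := heB.resolve_left heI
  rw [mem_intActive_iff hB.subset_ground]
  refine ⟨heB, fun hcl => ?_⟩
  obtain ⟨C, hCsub, hC, heC⟩ := exists_isCircuit_of_mem_closure hcl (by simp)
  obtain ⟨f, hf, hfY, hmin⟩ := hC.exists_notMem_greedyCompletion (fun h => heI (h heC))
  rcases hCsub hf.1 with rfl | ⟨hfB, -⟩ | hfe
  · exact hfY heY
  · exact hfY (hfB.resolve_left hf.2)
  · exact (hmin e ⟨heC, heI⟩).not_gt hfe

theorem RelatedBasis.diff_eq_greedyCompletion (h : M.RelatedBasis I B) :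
    B \ I = M.greedyCompletion I := by
  obtain ⟨hB, hIB, hact⟩ := h
  have key : ∀ f ∈ B \ I, f ∉ M.closure ((B \ {f}) ∪ Ioi f) := fun f hf =>
    ((mem_intActive_iff hB.subset_ground).1 (hact hf)).2
  refine Subset.antisymm ?_ ?_
  · intro e he
    refine ⟨hB.subset_ground he.1, fun hcl => key e he (M.closure_subset_closure ?_ hcl)⟩
    refine union_subset_union_left _ fun f hf => ⟨hIB hf, ?_⟩
    rintro rfl
    exact he.2 hf
  · intro e he
    have heI : e ∉ I := fun h =>
      Set.disjoint_left.1 (disjoint_greedyCompletion (hIB.trans hB.subset_ground)) h he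
    refine ⟨?_, heI⟩
    by_contra heB
    obtain ⟨C, hCB, hC, heC⟩ := exists_isCircuit_of_mem_closure
      (show e ∈ M.closure B from hB.closure_eq ▸ he.1) heB
    -- Such an `f` lies in `B \ I` below `e`, and `C` shows that it is not internally active in `B`.
    have hex : ∃ f ∈ C \ {e}, f ∉ I ∪ Ioi e := by
      by_contra! hcon
      exact he.2 (M.closure_subset_closure hcon (hC.mem_closure_sdiff_singleton_of_mem heC))
    obtain ⟨f, ⟨hfC, hfe⟩, hf⟩ := hex
    rw [mem_union, not_or] at hf
    have hfB := (hCB hfC).resolve_left hfe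
    refine key f ⟨hfB, hf.1⟩
      (M.closure_subset_closure ?_ (hC.mem_closure_sdiff_singleton_of_mem hfC))
    rintro g ⟨hgC, hgf⟩
    rcases hCB hgC with rfl | hg
    · exact Or.inr (lt_of_le_of_ne (not_lt.1 hf.2) hfe)
    · exact Or.inl ⟨hg, hgf⟩

theorem Indep.deleted_eq_greedyCompletion [M.Finite] (hI : M.Indep I) :
    M.deleted I = M.greedyCompletion I := by
  ext e
  constructor
  · rintro ⟨B, hB, he⟩
    exact hB.diff_eq_greedyCompletion ▸ he
  · intro he
    have h := hI.relatedBasis_union_greedyCompletion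
    exact ⟨_, h, h.diff_eq_greedyCompletion.symm.subset he⟩

/-! ### The greedy basis of a set -/

/-- The basis of `C` that a greedy algorithm picks, running through `C` from the smallest element
up. -/
def greedyBasis (M : Matroid α) (C : Set α) : Set α := {e | e ∈ C ∧ e ∉ M.closure (C ∩ Iio e)}

theorem greedyBasis_indep [M.Finite] (hC : C ⊆ M.E) : M.Indep (M.greedyBasis C) := by
  rw [indep_iff_forall_subset_not_isCircuit (fun e he => hC he.1)]
  intro D hDsub hD
  obtain ⟨e, he, hmax⟩ := exists_max_image D id (M.set_finite D hD.subset_ground) hD.nonempty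
  refine (hDsub he).2 (M.closure_subset_closure ?_ (hD.mem_closure_sdiff_singleton_of_mem he))
  rintro f ⟨hfD, hfe⟩
  exact ⟨(hDsub hfD).1, lt_of_le_of_ne (hmax f hfD) hfe⟩

theorem inter_Iio_subset_closure_greedyBasis [M.Finite] (hC : C ⊆ M.E) (e : α) :
    C ∩ Iio e ⊆ M.closure (M.greedyBasis C ∩ Iio e) := by
  by_contra hne
  obtain ⟨f, ⟨⟨hfC, hfe⟩, hf⟩, hmin⟩ :=
    exists_min_image ((C ∩ Iio e) \ M.closure (M.greedyBasis C ∩ Iio e)) id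
    ((M.set_finite C hC).subset (sdiff_subset.trans inter_subset_left)) (sdiff_nonempty.2 hne)
  have hsub : M.greedyBasis C ∩ Iio e ⊆ M.E := fun g hg => hC hg.1.1
  have hcl : f ∈ M.closure (C ∩ Iio f) := by
    by_contra h
    exact hf (M.subset_closure _ hsub ⟨⟨hfC, h⟩, hfe⟩)
  refine hf (closure_subset_closure_of_subset_closure ?_ hcl)
  rintro g ⟨hgC, hgf⟩
  by_contra hg
  exact (hmin g ⟨⟨hgC, lt_trans hgf hfe⟩, hg⟩).not_gt hgf

theorem subset_greedyBasis_union_extActive [M.Finite] (hC : C ⊆ M.E) :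
    C ⊆ M.greedyBasis C ∪ M.extActive (M.greedyBasis C) := by
  intro e he
  by_cases heI : e ∈ M.greedyBasis C
  · exact Or.inl heI
  · refine Or.inr (mem_extActive_iff.2 ⟨hC he, heI, ?_⟩)
    have hcl : e ∈ M.closure (C ∩ Iio e) := by
      by_contra h
      exact heI ⟨he, h⟩
    exact closure_subset_closure_of_subset_closure
      (inter_Iio_subset_closure_greedyBasis hC e) hcl

/-- An element of `J` spanned by smaller elements of `C` would be spanned by smaller elements of
`J`. -/
theorem Indep.inter_subset_greedyBasis (hJ : M.Indep J) (hC : C ⊆ J ∪ M.extActive J) :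
    C ∩ J ⊆ M.greedyBasis C := fun e he =>
  ⟨he.1, fun h => hJ.notMem_closure_inter_Iio he.2 (closure_inter_Iio_subset hC hJ.subset_ground e h)⟩

theorem Indep.eq_of_subset_union_extActive (hI : M.Indep I) (hJ : M.Indep J)
    (hIJ : I ⊆ J ∪ M.extActive J) (hJI : J ⊆ I ∪ M.extActive I) : I = J := by
  have aux : ∀ {I J : Set α}, M.Indep J → I ⊆ J ∪ M.extActive J → J ⊆ I ∪ M.extActive I →
      J ⊆ I := fun {I J} hJ hIJ hJI e he => (hJI he).resolve_right fun h =>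
    (mem_extActive_iff.1 (hJ.extActive_subset_extActive hIJ h)).2.1 he
  exact Subset.antisymm (aux hI hJI hIJ) (aux hJ hIJ hJI)

/-! ### Comparison with the external/internal order -/

theorem extIntLE_of_subset (I J : M.IndepSets) (hIJ : I.1 ⊆ J.1 ∪ M.extActive J.1) :
    M.ExtIntLE I J := by
  have hJ : M.Indep J.1 := J.2
  have hI : M.Indep I.1 := I.2
  by_cases hrel : M.InternallyRelated I.1 J.1
  · refine Or.inr ⟨hrel, fun e heI => (hIJ heI).resolve_right fun he => ?_⟩
    obtain ⟨B, hIB, hJB⟩ := hrel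
    -- Here `e ∈ B` would be spanned by `J ⊆ B \ {e}`.
    have heJ := (mem_extActive_iff.1 he).2.1
    refine hIB.1.indep.notMem_closure_sdiff_of_mem (hIB.2.1 heI)
      (M.closure_subset_closure (show J.1 ⊆ B \ {e} from fun f hf => ⟨hJB.2.1 hf, ?_⟩)
        (extActive_subset_closure he))
    rintro rfl
    exact heJ hf
  · refine Or.inl ⟨hrel, union_subset ?_
      ((hJ.extActive_subset_extActive hIJ).trans subset_union_right)⟩
    rintro e ⟨heI, heA⟩
    rcases hIJ heI with heJ | heJ
    · refine Or.inl ⟨heJ, fun hact => heA ?_⟩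
      rw [mem_intActive_iff hI.subset_ground]
      rw [mem_intActive_iff hJ.subset_ground] at hact
      refine ⟨heI, fun hcl => hact.2 ?_⟩
      rw [← closure_inter_ground] at hcl
      refine closure_subset_closure_of_subset_closure ?_ hcl
      have hsub : ((J.1 \ {e}) ∪ Ioi e) ∩ M.E ⊆ M.closure ((J.1 \ {e}) ∪ Ioi e) := by
        rw [← closure_inter_ground]
        exact M.subset_closure _ inter_subset_right
      rintro f ⟨⟨hfI, hfe⟩ | hfe, hfE⟩
      · rcases lt_trichotomy f e with hlt | rfl | hgt
        · rcases hIJ hfI with hfJ | hfJ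
          · exact hsub ⟨Or.inl ⟨hfJ, hfe⟩, hfE⟩
          -- Since `f < e`, the elements of `J` below `f` that span it avoid `e`.
          · refine M.closure_subset_closure ?_ (mem_extActive_iff.1 hfJ).2.2
            exact fun g hg => Or.inl ⟨hg.1, (lt_trans hg.2 hlt).ne⟩
        · exact absurd rfl hfe
        · exact hsub ⟨Or.inr hgt, hfE⟩
      · exact hsub ⟨Or.inr hfe, hfE⟩
    · exact Or.inr heJ

/-! ### Facets and faces of the augmented complex -/

section AugFacet

theorem x_mem_augFacet {I : M.IndepSets} :
    XYZ.x e ∈ M.augFacet I ↔ e ∈ M.E ∧ e ∉ M.extActive I.1 := by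
  have h1 : e ∈ I.1 → e ∈ M.E := fun h => I.2.subset_ground h
  have h2 : e ∈ M.extActive I.1 → e ∉ I.1 := fun h => h.1.2
  simp only [augFacet, extPassive, mem_union, mem_image, XYZ.x.injEq, exists_eq_right, reduceCtorEq,
    and_false, exists_false, or_false, mem_sdiff]
  tauto

theorem y_mem_augFacet [M.Finite] {I : M.IndepSets} :
    XYZ.y e ∈ M.augFacet I ↔ e ∈ M.greedyCompletion I.1 := by
  simp [augFacet, Indep.deleted_eq_greedyCompletion I.2]

theorem z_mem_augFacet {I : M.IndepSets} :
    XYZ.z e ∈ M.augFacet I ↔ e ∈ I.1 ∪ M.extActive I.1 := by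
  simp [augFacet]

/-- `E \ EA(I)` and `EA(I)` make up `E`, while `I` and `Y_I` make up a basis. -/
theorem augFacet_encard [M.Finite] (I : M.IndepSets) :
    (M.augFacet I).encard = M.E.encard + M.eRank := by
  have hI : M.Indep I.1 := I.2
  have hx : I.1 ∪ M.extPassive I.1 = M.E \ M.extActive I.1 := by
    ext e
    have := x_mem_augFacet (M := M) (e := e) (I := I)
    simpa [augFacet] using this
  have hEA : M.extActive I.1 ⊆ M.E := fun e he => he.1.1
  have hz : Disjoint I.1 (M.extActive I.1) := Set.disjoint_left.2 fun e he h => h.1.2 he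
  rw [augFacet, encard_union_eq, encard_union_eq, (show Function.Injective (XYZ.x (α := α)) from
    fun _ _ h => XYZ.x.inj h).encard_image, (show Function.Injective (XYZ.y (α := α)) from
    fun _ _ h => XYZ.y.inj h).encard_image, (show Function.Injective (XYZ.z (α := α)) from
    fun _ _ h => XYZ.z.inj h).encard_image, hx, hI.deleted_eq_greedyCompletion,
    encard_union_eq hz, ← hI.union_greedyCompletion_isBase.encard_eq_eRank,
    encard_union_eq (disjoint_greedyCompletion hI.subset_ground),
    ← encard_sdiff_add_encard_of_subset hEA]
  · ring
  · rw [Set.disjoint_left]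
    rintro _ ⟨e, -, rfl⟩ ⟨f, -, h⟩
    cases h
  · rw [Set.disjoint_left]
    rintro _ (⟨e, -, rfl⟩ | ⟨e, -, rfl⟩) ⟨f, -, h⟩ <;> cases h

theorem z_image_subset_augFacet {I : M.IndepSets} :
    XYZ.z '' S ⊆ M.augFacet I ↔ S ⊆ I.1 ∪ M.extActive I.1 := by
  rw [image_subset_iff]
  exact forall₂_congr fun e _ => z_mem_augFacet

theorem z_image_subset_augFacet_self (I : M.IndepSets) : XYZ.z '' I.1 ⊆ M.augFacet I :=
  z_image_subset_augFacet.2 subset_union_left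

/-- Replacing `J` by the greedy basis of the z-part loses nothing: external activity and the span
can only shrink, so the x- and y-parts of the facet can only grow. -/
theorem exists_z_image_subset_subset_augFacet [M.Finite] {G : Set (XYZ α)} {J : M.IndepSets}
    (hG : G ⊆ M.augFacet J) :
    ∃ I : M.IndepSets, XYZ.z '' I.1 ⊆ G ∧ G ⊆ M.augFacet I ∧ XYZ.z ⁻¹' G ∩ J.1 ⊆ I.1 := by
  have hJ : M.Indep J.1 := J.2
  have hCJ : XYZ.z ⁻¹' G ⊆ J.1 ∪ M.extActive J.1 := fun e he => z_mem_augFacet.1 (hG he)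
  have hCE : XYZ.z ⁻¹' G ⊆ M.E :=
    hCJ.trans (union_subset hJ.subset_ground fun e he => he.1.1)
  have hIJ : M.greedyBasis (XYZ.z ⁻¹' G) ⊆ J.1 ∪ M.extActive J.1 := fun e he => hCJ he.1
  refine ⟨⟨_, greedyBasis_indep hCE⟩, ?_, ?_, hJ.inter_subset_greedyBasis hCJ⟩
  · rintro _ ⟨e, he, rfl⟩
    exact he.1
  · rintro (e | e | e) he
    · have := x_mem_augFacet.1 (hG he)
      exact x_mem_augFacet.2 ⟨this.1, fun h => this.2 (hJ.extActive_subset_extActive hIJ h)⟩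
    · refine y_mem_augFacet.2 (greedyCompletion_anti ?_ (y_mem_augFacet.1 (hG he)))
      exact hIJ.trans (union_subset (M.subset_closure _ hJ.subset_ground) extActive_subset_closure)
    · exact z_mem_augFacet.2 (subset_greedyBasis_union_extActive hCE he)

theorem augFacet_eq_of_subset [M.Finite] {I J : M.IndepSets} (h : M.augFacet I ⊆ M.augFacet J) :
    I = J := by
  have heq : M.augFacet I = M.augFacet J := (M.augFacet_finite I).eq_of_subset_of_encard_le h
    (by rw [augFacet_encard, augFacet_encard])
  refine Subtype.ext (Indep.eq_of_subset_union_extActive I.2 J.2 ?_ ?_)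
  · exact z_image_subset_augFacet.1 (heq ▸ z_image_subset_augFacet_self I)
  · exact z_image_subset_augFacet.1 (heq.symm ▸ z_image_subset_augFacet_self J)

theorem isFacet_augComplex_iff [M.Finite] {G : Set (XYZ α)} :
    M.augComplex.IsFacet G ↔ ∃ I, M.augFacet I = G := by
  constructor
  · rintro ⟨⟨I, hI⟩, hmax⟩
    exact ⟨I, Subset.antisymm (hmax ⟨I, Subset.rfl⟩ hI) hI⟩
  · rintro ⟨I, rfl⟩
    refine ⟨⟨I, Subset.rfl⟩, ?_⟩
    rintro G ⟨J, hJ⟩ hIG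
    obtain rfl := augFacet_eq_of_subset (hIG.trans hJ)
    exact hJ

/-! ### Restriction sets and the shelling -/

variable {prec : M.IndepSets → M.IndepSets → Prop}

theorem IsExtIntLinearExtension.eq_or_prec (hprec : M.IsExtIntLinearExtension prec)
    {I J : M.IndepSets} (h : XYZ.z '' I.1 ⊆ M.augFacet J) : I = J ∨ prec I J :=
  or_iff_not_imp_left.2 (hprec.2 I J (extIntLE_of_subset I J (z_image_subset_augFacet.1 h)))

theorem IsExtIntLinearExtension.isRestrictionMap [M.Finite]
    (hprec : M.IsExtIntLinearExtension prec) :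
    IsRestrictionMap prec M.augFacet (fun I => XYZ.z '' I.1) := by
  have := hprec.1
  refine fun J => ⟨z_image_subset_augFacet_self J, fun A hA => ⟨fun hJA I hIJ hAI => ?_, ?_⟩⟩
  · rcases hprec.eq_or_prec (hJA.trans hAI) with rfl | h
    · exact irrefl_of prec _ hIJ
    · exact asymm_of prec hIJ h
  · intro h
    obtain ⟨I, hIA, hAI, -⟩ := exists_z_image_subset_subset_augFacet hA
    rcases hprec.eq_or_prec (hIA.trans hA) with rfl | hIJ
    · exact hIA
    · exact absurd hAI (h I hIJ)

theorem IsExtIntLinearExtension.isShellingOrder [M.Finite]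
    (hprec : M.IsExtIntLinearExtension prec) :
    IsShellingOrder M.augComplex prec M.augFacet where
  finite := (M.ground_finite.finite_subsets.subset fun _ hI => Indep.subset_ground hI).to_subtype
  total := hprec.1
  pure s t hs ht := by
    obtain ⟨I, rfl⟩ := isFacet_augComplex_iff.1 hs
    obtain ⟨J, rfl⟩ := isFacet_augComplex_iff.1 ht
    rw [ncard_def, ncard_def, augFacet_encard, augFacet_encard]
  injective _ _ h := augFacet_eq_of_subset h.subset
  range_eq := by
    ext G
    exact isFacet_augComplex_iff.symm
  shelling I K hIK := by
    have hR := hprec.isRestrictionMap K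
    have hnot : ¬ XYZ.z '' K.1 ⊆ M.augFacet I := (hR.2 _ hR.1).1 Subset.rfl I hIK
    obtain ⟨v, hvK, hvI⟩ := not_subset.1 hnot
    -- Removing `v` destroys the restriction set of `F(K)`, so what remains lies in an earlier
    -- facet.
    have hex : ∃ J, prec J K ∧ M.augFacet K \ {v} ⊆ M.augFacet J := by
      by_contra! h
      exact ((hR.2 _ sdiff_subset).2 h hvK).2 rfl
    obtain ⟨J, hJK, hJ⟩ := hex
    have hvJ : v ∉ M.augFacet J := fun hv => by
      have hsub : M.augFacet K ⊆ M.augFacet J := fun w hw => by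
        by_cases hwv : w = v
        · exact hwv ▸ hv
        · exact hJ ⟨hw, hwv⟩
      exact (hR.2 _ Subset.rfl).1 hR.1 J hJK hsub
    have heq : M.augFacet J ∩ M.augFacet K = M.augFacet K \ {v} := by
      refine Subset.antisymm ?_ fun w hw => ⟨hJ hw, hw.1⟩
      rintro w ⟨hwJ, hwK⟩
      exact ⟨hwK, fun hwv => hvJ (hwv ▸ hwJ)⟩
    refine ⟨J, hJK, v, hR.1 hvK, ?_, heq⟩
    rw [heq]
    rintro w ⟨hwI, hwK⟩
    exact ⟨hwK, fun hwv => hvI (hwv ▸ hwI)⟩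

theorem propertyH_augFacet [M.Finite] :
    PropertyH M.augComplex M.augFacet (fun I => XYZ.z '' I.1) := by
  rintro G - J hGJ _ hv ⟨e, heJ, rfl⟩
  obtain ⟨I, hIG, hGI, hI⟩ := exists_z_image_subset_subset_augFacet hGJ
  exact ⟨I, hIG, hGI, mem_image_of_mem _ (hI ⟨hv, heJ⟩)⟩

end AugFacet

end Matroid

theorem mainTheorem3 {α : Type*} [LinearOrder α] (M : Matroid α) [M.Finite]
    (prec : M.IndepSets → M.IndepSets → Prop) (hprec : M.IsExtIntLinearExtension prec) :
    IsCapitalHShelling M.augComplex prec M.augFacet ∧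
      ∃ Γ : SetComplex (XYZ α), IsSmallHShelling M.augComplex prec M.augFacet Γ ∧
        Γ.Isomorphic M.indepComplex :=
  ⟨⟨hprec.isShellingOrder, _, hprec.isRestrictionMap, Matroid.propertyH_augFacet⟩,
    M.zIndepComplex, ⟨hprec.isShellingOrder, _, hprec.isRestrictionMap, rfl⟩,
    Matroid.zIndepComplex_isomorphic⟩
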